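/- Let $r\ge 2$ be an integer and $1<p<\infty$. Let $\varphi,\psi\in L^1(\mathbb R)$ be real-valued, with $\varphi$ bounded on $\mathbb R$ and $\psi$ bounded in a neighbourhood of $0$. For $\nu\in\mathbb N_0$ put $$m_\nu(\varphi,u)=\sum_{k\in\mathbb Z}\varphi(u-k)(k-u)^\nu\quad(u\in\mathbb R),\qquad \widetilde m_\nu(\psi)=\int_{\mathbb R}u^\nu\psi(u)\,du .$$ Assume: - $m_0(\varphi,u)=1$ for all $u\in\mathbb R$, and $\widetilde m_0(\psi)=1$; - $M_0(\psi):=\sup_{u\in\mathbb R}\sum_{k\in\mathbb Z}|\psi(u-k)|<\infty$; - (i) for $\nu=1,\dots,r$ the moment $m_\nu(\varphi,u)=:m_\nu(\varphi)$ does not depend on $u$ (and $m_0(\varphi):=1$); - (ii) $\displaystyle\sum_{\nu=0}^{i}\binom i\nu m_{i-\nu}(\varphi)\,\widetilde m_\nu(\psi)=0$ for $i=1,\dots,r-1$; - ($\Theta$) for some $\theta>pr+1$, $\varphi(u)=\mathcal O(|u|^{-\theta})$ and $\psi(u)=\mathcal O(|u|^{-\theta})$ as $|u|\to\infty$. Then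 there is a constant $\Gamma_p>0$, not depending on $f$ or $w$, such that for every $f\in L^p(\mathbb R)$ and every $w>0$ the operator $$(\mathcal D_w^{\varphi,\psi}f)(x)=\sum_{k\in\mathbb Z}\varphi(wx-k)\,w\int_{\mathbb R}\psi(wu-k)f(u)\,du,\qquad x\in\mathbb R,$$ is well defined (the integrands are integrable and the series converges absolutely for every $x$), $\mathcal D_w^{\varphi,\psi}f\in L^p(\mathbb R)$, and $$\|\mathcal D_w^{\varphi,\psi}f-f\|_p\le\Gamma_p\,\omega_r\!\left(f,\tfrac1w\right)_p ,$$ where $\displaystyle\omega_r(f,\delta)_p=\sup_{|t|\le\delta}\Big\|\sum_{j=0}^r\binom rj(-1)^{r-j}f(\cdot+jt)\Big\|_p$. -/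

import Mathlib

open MeasureTheory Filter Topology
open scoped ENNReal

namespace Durrmeyer

noncomputable section

/-- Discrete algebraic moment `m_ν(φ, u) = ∑_{k ∈ ℤ} φ(u - k) (k - u)^ν`. -/
def discreteMoment (φ : ℝ → ℝ) (ν : ℕ) (u : ℝ) : ℝ :=
  ∑' k : ℤ, φ (u - k) * ((k : ℝ) - u) ^ ν

/-- Continuous algebraic moment `∫ u^ν ψ(u) du`. -/
def continuousMoment (ψ : ℝ → ℝ) (ν : ℕ) : ℝ :=
  ∫ u : ℝ, u ^ ν * ψ u

/-- Discrete absolute moment `M_ν(ξ) = sup_u ∑_{k ∈ ℤ} |ξ(u - k)| |u - k|^ν`, with values in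
`[0, ∞]`. -/
def discreteAbsMoment (ξ : ℝ → ℝ) (ν : ℝ) : ℝ≥0∞ :=
  ⨆ u : ℝ, ∑' k : ℤ, ENNReal.ofReal (|ξ (u - k)| * |u - k| ^ ν)

/-- A discrete kernel: integrable, bounded, and `m_0(φ, u) = 1` for every `u`. -/
structure IsDiscreteKernel (φ : ℝ → ℝ) : Prop where
  integrable : Integrable φ
  bounded : ∃ C : ℝ, ∀ u, |φ u| ≤ C
  moment_zero : ∀ u, discreteMoment φ 0 u = 1

/-- A continuous kernel: integrable, bounded in a neighbourhood of the origin, of integral `1`. -/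
structure IsContinuousKernel (ψ : ℝ → ℝ) : Prop where
  integrable : Integrable ψ
  bounded_near_zero : ∃ C : ℝ, ∀ᶠ u in 𝓝 (0 : ℝ), |ψ u| ≤ C
  moment_zero : continuousMoment ψ 0 = 1

/-- Decay condition: `ξ(u) = O(|u|^{-θ})` as `|u| → ∞`. -/
def DecayCondition (ξ : ℝ → ℝ) (θ : ℝ) : Prop :=
  ξ =O[comap (fun u : ℝ => |u|) atTop] fun u : ℝ => |u| ^ (-θ)

/-- Condition (i): the moments `m_ν(φ, u)`, `1 ≤ ν ≤ r`, do not depend on `u`. -/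
def ConstantMoments (φ : ℝ → ℝ) (r : ℕ) : Prop :=
  ∀ ν : ℕ, 1 ≤ ν → ν ≤ r → ∀ u v : ℝ, discreteMoment φ ν u = discreteMoment φ ν v

/-- Condition (ii): the vanishing moment condition of Durrmeyer (Strang-Fix) type. It is used only
together with condition (i), under which the moments of `φ` that occur do not depend on `u`. -/
def VanishingMoments (φ ψ : ℝ → ℝ) (r : ℕ) : Prop :=
  ∀ i : ℕ, 1 ≤ i → i ≤ r - 1 → ∀ u : ℝ,
    ∑ ν ∈ Finset.range (i + 1),
      (i.choose ν : ℝ) * discreteMoment φ (i - ν) u * continuousMoment ψ ν = 0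

/-- The Durrmeyer sampling operator
`(D_w f)(x) = ∑_{k ∈ ℤ} φ(wx - k) w ∫ ψ(wu - k) f(u) du`. -/
def operator (φ ψ : ℝ → ℝ) (w : ℝ) (f : ℝ → ℝ) (x : ℝ) : ℝ :=
  ∑' k : ℤ, φ (w * x - k) * (w * ∫ u : ℝ, ψ (w * u - k) * f u)

/-- The finite difference `Δ^r_t(f, x) = ∑_{j=0}^r (r choose j) (-1)^{r-j} f(x + j t)`. -/
def finiteDiff (r : ℕ) (t : ℝ) (f : ℝ → ℝ) (x : ℝ) : ℝ :=
  ∑ j ∈ Finset.range (r + 1), (r.choose j : ℝ) * (-1) ^ (r - j) * f (x + j * t)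

/-- The modulus of smoothness `ω_r(f, δ)_p = sup_{|t| ≤ δ} ‖Δ^r_t(f, ·)‖_p`, with values in
`[0, ∞]`. -/
def modulus (r : ℕ) (f : ℝ → ℝ) (δ : ℝ) (p : ℝ≥0∞) : ℝ≥0∞ :=
  ⨆ (t : ℝ) (_ : |t| ≤ δ), eLpNorm (finiteDiff r t f) p volume

end

end Durrmeyer

/-!
The proof passes through the K-functional. A dilation reduces the claim to the scale `w = 1`
(`operator_eq_unitOperator`, `modulus_dilate_le`), where three facts are combined.

* *Boundedness.* Both kernels are dominated by the envelope `(1 + |u|)^(-θ)`, and the discrete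
  convolution of two envelopes is again dominated by an envelope. Hence `D f` is dominated pointwise
  by the convolution of `|f|` with an integrable function (`KernelPair.exists_tsum_enorm_le`):
  Hölder's inequality gives absolute convergence at every point, and Minkowski's integral inequality
  gives boundedness on `L^p` (`KernelPair.exists_eLpNorm_le`).
* *A Jackson estimate for smooth functions.* The moment conditions say that `D` reproduces
  polynomials of degree less than `r` (`KernelPair.hasSum_integral_pow`), so that `D h - h` at `x`
  is `D` applied to the Taylor remainder of `h` at `x`. The integral form of the remainder and
  `θ - r > 1` then bound `‖D h - h‖_p` by a multiple of `‖h^(r)‖_p`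
  (`KernelPair.exists_eLpNorm_sub_le`).
* *Smoothing.* For continuous bounded `f`, a combination `h` of `r`-fold Steklov means of steps
  `1/r, 2/r, …, 1` satisfies `‖f - h‖_p ≤ ω_r(f, 1)_p`, since `f - h` is an average of differences
  `Δ^r_t f` with `|t| ≤ 1` (`eLpNorm_sub_smoothing_le`), and `h^(r)` is a combination of differences
  `Δ^r_{j/r} f`, so that `‖h^(r)‖_p` is at most a multiple of `ω_r(f, 1)_p`
  (`eLpNorm_smoothing_le`).

Writing `D f - f = D (f - h) + (D h - h) - (f - h)` proves the estimate for continuous functions of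
compact support. These are dense in `L^p`, and both sides of the estimate are continuous in `f`.
-/

namespace Durrmeyer

/-! ### The algebraic envelope -/

/-- The algebraic envelope `(1 + |u|)^(-θ)`. -/
noncomputable def envelope (θ u : ℝ) : ℝ := (1 + |u|) ^ (-θ)

lemma envelope_pos (θ u : ℝ) : 0 < envelope θ u := by
  unfold envelope; positivity

lemma envelope_nonneg (θ u : ℝ) : 0 ≤ envelope θ u := (envelope_pos θ u).le

lemma continuous_envelope (θ : ℝ) : Continuous (envelope θ) := by
  unfold envelope
  exact (continuous_const.add continuous_abs).rpow_const fun u =>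
    Or.inl (by positivity : (0 : ℝ) < 1 + |u|).ne'

lemma envelope_neg (θ u : ℝ) : envelope θ (-u) = envelope θ u := by
  simp [envelope]

lemma envelope_mul_pow_le (θ : ℝ) (n : ℕ) (u : ℝ) :
    envelope θ u * |u| ^ n ≤ envelope (θ - n) u := by
  have h1 : 0 < 1 + |u| := by positivity
  have h2 : envelope (θ - n) u = envelope θ u * (1 + |u|) ^ n := by
    unfold envelope
    rw [← Real.rpow_natCast, ← Real.rpow_add h1]
    congr 1; ring
  rw [h2]
  refine mul_le_mul_of_nonneg_left ?_ (envelope_nonneg _ _)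
  exact pow_le_pow_left₀ (abs_nonneg _) (by linarith [abs_nonneg u]) n

lemma envelope_rpow (θ q u : ℝ) : envelope θ u ^ q = envelope (θ * q) u := by
  unfold envelope
  rw [← Real.rpow_mul (by positivity)]
  congr 1; ring

/-- Slow variation: shrinking `1 + |u|` by a factor `2` costs at most the factor `2 ^ θ`. -/
lemma envelope_le_of_le {θ : ℝ} (hθ : 0 ≤ θ) {u v : ℝ} (h : 1 + |v| ≤ 2 * (1 + |u|)) :
    envelope θ u ≤ 2 ^ θ * envelope θ v := by
  unfold envelope
  have h1 : 0 < 1 + |u| := by positivity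
  have h2 : 0 < 1 + |v| := by positivity
  rw [Real.rpow_neg h1.le, Real.rpow_neg h2.le, ← div_eq_mul_inv, ← one_div,
    div_le_div_iff₀ (by positivity) (by positivity), one_mul, ← Real.mul_rpow (by norm_num) h1.le]
  exact Real.rpow_le_rpow h2.le h hθ

lemma integrable_envelope {θ : ℝ} (hθ : 1 < θ) : Integrable (envelope θ) := by
  have := integrable_one_add_norm (E := ℝ) (μ := volume) (r := θ) (by simpa using hθ)
  exact this.congr (.of_forall fun u => by simp [envelope])

lemma lintegral_envelope_lt_top {θ : ℝ} (hθ : 1 < θ) :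
    ∫⁻ u, ENNReal.ofReal (envelope θ u) < ⊤ := by
  have := (integrable_envelope hθ).lintegral_lt_top
  exact this

lemma memLp_envelope {θ q : ℝ} (hθ : 1 < θ) (hq : 1 < q) :
    MemLp (envelope θ) (ENNReal.ofReal q) := by
  have hq0 : 0 < q := by linarith
  refine (integrable_norm_rpow_iff (continuous_envelope θ).aestronglyMeasurable
    (by simpa using hq0) ENNReal.ofReal_ne_top).1 ?_
  simp only [ENNReal.toReal_ofReal hq0.le, Real.norm_eq_abs, abs_of_nonneg (envelope_nonneg _ _),
    envelope_rpow]
  exact integrable_envelope (by nlinarith)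

lemma summable_envelope_int {θ : ℝ} (hθ : 1 < θ) : Summable fun k : ℤ => envelope θ k := by
  have h1 : Summable fun n : ℕ => envelope θ n := by
    refine Summable.of_nonneg_of_le (fun n => envelope_nonneg _ _) (fun n => ?_)
      ((summable_nat_add_iff 1).2 (Real.summable_nat_rpow.2 (neg_lt_neg hθ)))
    simp [envelope, add_comm]
  exact Summable.of_nat_of_neg (by simpa using h1) (by simpa [envelope_neg] using h1)

/-- The integer translates of an integrable envelope have uniformly bounded sums. -/
lemma exists_tsum_envelope_le {θ : ℝ} (hθ : 1 < θ) :
    ∃ S : ℝ, 0 < S ∧ ∀ x : ℝ, Summable (fun k : ℤ => envelope θ (x - k)) ∧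
      ∑' k : ℤ, envelope θ (x - k) ≤ S := by
  set F : ℤ → ℝ := fun k => 2 ^ θ * envelope θ k with hF
  have hs : Summable F := (summable_envelope_int hθ).mul_left (2 ^ θ)
  refine ⟨∑' k, F k, hs.tsum_pos
    (fun k => mul_nonneg (by positivity) (envelope_nonneg _ _)) 0
    (mul_pos (by positivity) (envelope_pos _ _)), fun x => ?_⟩
  have hs' : Summable fun k : ℤ => F (k - ⌊x⌋) :=
    (Equiv.subRight ⌊x⌋).summable_iff (f := F) |>.2 hs
  have hle : ∀ k : ℤ, envelope θ (x - k) ≤ F (k - ⌊x⌋) := by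
    intro k
    refine envelope_le_of_le (by linarith) ?_
    have h1 := Int.floor_le x
    have h2 := Int.lt_floor_add_one x
    have h3 : |((k - ⌊x⌋ : ℤ) : ℝ)| ≤ |x - k| + 1 := by
      push_cast
      rw [abs_le]
      constructor <;> cases abs_cases (x - k) <;> linarith
    linarith [abs_nonneg (x - k)]
  have hx : Summable (fun k : ℤ => envelope θ (x - k)) :=
    Summable.of_nonneg_of_le (fun k => envelope_nonneg _ _) hle hs'
  refine ⟨hx, (hx.tsum_le_tsum hle hs').trans_eq ?_⟩
  exact (Equiv.subRight ⌊x⌋).tsum_eq F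

/-- One of two points is at least half their distance away from a third one. -/
lemma envelope_mul_envelope_le {θ : ℝ} (hθ : 0 ≤ θ) (a b : ℝ) :
    envelope θ a * envelope θ b ≤
      2 ^ θ * envelope θ (b - a) * (envelope θ a + envelope θ b) := by
  have ha := envelope_pos θ a
  have hb := envelope_pos θ b
  have hab := envelope_pos θ (b - a)
  have h2 : (0 : ℝ) < 2 ^ θ := by positivity
  have htri : |b - a| ≤ |b| + |a| := abs_sub _ _
  rcases le_total |a| |b| with h | h
  · have := envelope_le_of_le hθ (u := b) (v := b - a) (by linarith)
    calc _ ≤ envelope θ a * (2 ^ θ * envelope θ (b - a)) := by gcongr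
      _ ≤ _ := by nlinarith [mul_pos (mul_pos h2 hab) hb]
  · have := envelope_le_of_le hθ (u := a) (v := b - a) (by linarith)
    calc _ ≤ (2 ^ θ * envelope θ (b - a)) * envelope θ b := by gcongr
      _ ≤ _ := by nlinarith [mul_pos (mul_pos h2 hab) ha]

/-- The discrete convolution of two envelopes is again dominated by the envelope. -/
lemma exists_tsum_envelope_mul_le {θ : ℝ} (hθ : 1 < θ) :
    ∃ K : ℝ, 0 < K ∧ ∀ x u : ℝ,
      ∑' k : ℤ, ENNReal.ofReal (envelope θ (x - k) * envelope θ (u - k)) ≤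
        ENNReal.ofReal (K * envelope θ (u - x)) := by
  obtain ⟨S, hS, h⟩ := exists_tsum_envelope_le hθ
  refine ⟨2 ^ θ * (2 * S), by positivity, fun x u => ?_⟩
  have hs := ((h x).1.add (h u).1).mul_left (2 ^ θ * envelope θ (u - x))
  calc ∑' k : ℤ, ENNReal.ofReal (envelope θ (x - k) * envelope θ (u - k))
      ≤ ∑' k : ℤ, ENNReal.ofReal (2 ^ θ * envelope θ (u - x) *
          (envelope θ (x - k) + envelope θ (u - k))) := by
        refine ENNReal.tsum_le_tsum fun k => ENNReal.ofReal_le_ofReal ?_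
        simpa using envelope_mul_envelope_le (by linarith : 0 ≤ θ) (x - k) (u - k)
    _ = ENNReal.ofReal (∑' k : ℤ, 2 ^ θ * envelope θ (u - x) *
          (envelope θ (x - k) + envelope θ (u - k))) := by
        refine (ENNReal.ofReal_tsum_of_nonneg (fun k => ?_) hs).symm
        have := envelope_nonneg θ (x - k)
        have := envelope_nonneg θ (u - k)
        have := envelope_nonneg θ (u - x)
        positivity
    _ ≤ _ := by
        refine ENNReal.ofReal_le_ofReal ?_
        rw [tsum_mul_left, (h x).1.tsum_add (h u).1]
        have h0 := envelope_nonneg θ (u - x)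
        have h1 := (h x).2
        have h2 := (h u).2
        calc _ ≤ 2 ^ θ * envelope θ (u - x) * (S + S) := by gcongr
          _ = _ := by ring

/-- A bounded function with the decay `O(|u|^{-θ})` is dominated by a multiple of the envelope. -/
lemma DecayCondition.exists_le_envelope {ξ : ℝ → ℝ} {θ : ℝ} (hθ : 0 ≤ θ)
    (h : DecayCondition ξ θ) {C : ℝ} (hC : ∀ u, |ξ u| ≤ C) :
    ∃ A : ℝ, 0 < A ∧ ∀ u, |ξ u| ≤ A * envelope θ u := by
  obtain ⟨c, hc0, hc⟩ := h.exists_pos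
  have hc := hc.bound
  rw [eventually_comap, eventually_atTop] at hc
  obtain ⟨R, hR⟩ := hc
  have hC0 : 0 ≤ C := (abs_nonneg _).trans (hC 0)
  set R' := max R 1
  have hR'1 : 1 ≤ R' := le_max_right _ _
  refine ⟨c * 2 ^ θ + C * (1 + R') ^ θ, by positivity, fun u => ?_⟩
  have hu1 : 0 < 1 + |u| := by positivity
  have he := envelope_pos θ u
  rcases le_total R' |u| with h | h
  · have h1 := hR |u| ((le_max_left _ _).trans h) u rfl
    have hu : 1 ≤ |u| := hR'1.trans h
    have hu0 : 0 < |u| := by linarith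
    have h2 : |u| ^ (-θ) ≤ 2 ^ θ * envelope θ u := by
      unfold envelope
      rw [Real.rpow_neg hu0.le, Real.rpow_neg hu1.le, ← div_eq_mul_inv, ← one_div,
        div_le_div_iff₀ (by positivity) (by positivity), one_mul,
        ← Real.mul_rpow (by norm_num) hu0.le]
      exact Real.rpow_le_rpow hu1.le (by linarith) hθ
    rw [Real.norm_eq_abs, Real.norm_eq_abs, abs_of_nonneg (by positivity : 0 ≤ |u| ^ (-θ))] at h1
    calc |ξ u| ≤ c * (2 ^ θ * envelope θ u) := h1.trans (by gcongr)
      _ ≤ c * (2 ^ θ * envelope θ u) + C * (1 + R') ^ θ * envelope θ u :=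
        le_add_of_nonneg_right (by positivity)
      _ = _ := by ring
  · have h2 : 1 ≤ (1 + R') ^ θ * envelope θ u := by
      unfold envelope
      rw [Real.rpow_neg hu1.le, ← div_eq_mul_inv, one_le_div (by positivity)]
      exact Real.rpow_le_rpow hu1.le (by linarith) hθ
    calc |ξ u| ≤ C * 1 := by simpa using hC u
      _ ≤ C * ((1 + R') ^ θ * envelope θ u) := by gcongr
      _ ≤ C * ((1 + R') ^ θ * envelope θ u) + c * 2 ^ θ * envelope θ u :=
        le_add_of_nonneg_right (by positivity)
      _ = _ := by ring

/-- A finite absolute moment of order `0` forces boundedness: each value of `ψ` is a single term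
of one of the sums. -/
lemma exists_bound_of_discreteAbsMoment_lt_top {ψ : ℝ → ℝ} (h : discreteAbsMoment ψ 0 < ⊤) :
    ∃ C : ℝ, ∀ u, |ψ u| ≤ C := by
  refine ⟨(discreteAbsMoment ψ 0).toReal, fun u => ?_⟩
  rw [← ENNReal.ofReal_le_iff_le_toReal h.ne]
  unfold discreteAbsMoment
  refine le_iSup_of_le u ?_
  refine le_trans ?_ (ENNReal.le_tsum (0 : ℤ))
  simp

/-! ### Boundedness of the operator on `L^p` -/

section

/-- Minkowski's integral inequality for a parameter measure `μ`: a function dominated pointwise by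
an average of functions of `L^p` norm at most `A` has norm at most `μ(T) A`. -/
lemma eLpNorm_le_of_enorm_le_lintegral {T : Type*} [MeasurableSpace T] {μ : Measure T} [SFinite μ]
    {p : ℝ} (hp : 1 < p) {g : ℝ → ℝ} {G : ℝ → T → ℝ} (hG : Measurable (Function.uncurry G))
    (hg : ∀ x, ‖g x‖ₑ ≤ ∫⁻ t, ‖G x t‖ₑ ∂μ) {A : ℝ≥0∞}
    (hA : ∀ᵐ t ∂μ, eLpNorm (fun x => G x t) (ENNReal.ofReal p) ≤ A) :
    eLpNorm g (ENNReal.ofReal p) ≤ μ Set.univ * A := by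
  have hp0 : 0 < p := by linarith
  have hpq := Real.HolderConjugate.conjExponent hp
  set q := p.conjExponent
  have hpne : ENNReal.ofReal p ≠ 0 := by simpa using hp0
  simp only [eLpNorm_eq_lintegral_rpow_enorm_toReal hpne ENNReal.ofReal_ne_top,
    ENNReal.toReal_ofReal hp0.le] at hA ⊢
  rw [one_div, ENNReal.rpow_inv_le_iff hp0]
  have hmeas : Measurable fun z : ℝ × T => ‖G z.1 z.2‖ₑ ^ p := (hG.enorm).pow_const p
  have hexp : 1 / q * p = p - 1 := by
    have h1 := hpq.inv_add_inv_eq_one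
    have h2 : 1 / q = 1 - p⁻¹ := by rw [one_div]; linarith
    rw [h2, sub_mul, inv_mul_cancel₀ hp0.ne', one_mul]
  -- Hölder's inequality in the parameter, against the constant function one
  have hx : ∀ x, ‖g x‖ₑ ^ p ≤ (∫⁻ t, ‖G x t‖ₑ ^ p ∂μ) * μ Set.univ ^ (p - 1) := by
    intro x
    have hm : Measurable fun t => ‖G x t‖ₑ := (hG.comp measurable_prodMk_left).enorm
    have h1 := ENNReal.lintegral_mul_le_Lp_mul_Lq μ hpq hm.aemeasurable
      (aemeasurable_const (b := (1 : ℝ≥0∞)))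
    simp only [Pi.mul_apply, mul_one, ENNReal.one_rpow, lintegral_one] at h1
    calc ‖g x‖ₑ ^ p ≤ ((∫⁻ t, ‖G x t‖ₑ ^ p ∂μ) ^ (1 / p) * μ Set.univ ^ (1 / q)) ^ p :=
          ENNReal.rpow_le_rpow ((hg x).trans h1) hp0.le
      _ = _ := by
          rw [ENNReal.mul_rpow_of_nonneg _ _ hp0.le, ← ENNReal.rpow_mul, ← ENNReal.rpow_mul, hexp,
            one_div_mul_cancel hp0.ne', ENNReal.rpow_one]
  have hA' : ∀ᵐ t ∂μ, ∫⁻ x, ‖G x t‖ₑ ^ p ≤ A ^ p := by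
    filter_upwards [hA] with t ht
    rwa [one_div, ENNReal.rpow_inv_le_iff hp0] at ht
  calc ∫⁻ x, ‖g x‖ₑ ^ p ≤ ∫⁻ x, (∫⁻ t, ‖G x t‖ₑ ^ p ∂μ) * μ Set.univ ^ (p - 1) :=
        lintegral_mono hx
    _ = (∫⁻ t, (∫⁻ x, ‖G x t‖ₑ ^ p) ∂μ) * μ Set.univ ^ (p - 1) := by
        rw [lintegral_mul_const _ hmeas.lintegral_prod_right',
          lintegral_lintegral_swap hmeas.aemeasurable]
    _ ≤ (∫⁻ _, A ^ p ∂μ) * μ Set.univ ^ (p - 1) := by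
        gcongr 1
        exact lintegral_mono_ae hA'
    _ = (μ Set.univ * A) ^ p := by
        rw [lintegral_const, ENNReal.mul_rpow_of_nonneg _ _ hp0.le, mul_assoc]
        have : μ Set.univ ^ p = μ Set.univ * μ Set.univ ^ (p - 1) := by
          conv_rhs => rw [← ENNReal.rpow_one (μ Set.univ), ← ENNReal.rpow_mul, one_mul,
            ← ENNReal.rpow_add_of_nonneg _ _ zero_le_one (by linarith)]
          congr 1; ring
        rw [this]; ring

lemma eLpNorm_comp_add_right {f : ℝ → ℝ} {q : ℝ≥0∞} (hf : AEStronglyMeasurable f) (a : ℝ) :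
    eLpNorm (fun x => f (x + a)) q = eLpNorm f q :=
  eLpNorm_comp_measurePreserving hf (measurePreserving_add_right volume a)

/-- Pairing a function dominated by the envelope with an `L^p` function, by Hölder's inequality. -/
lemma integrable_mul_of_le_envelope {ψ f : ℝ → ℝ} {B θ p : ℝ} (hθ : 1 < θ) (hp : 1 < p)
    (hψm : AEStronglyMeasurable ψ) (hψ : ∀ u, |ψ u| ≤ B * envelope θ u)
    (hf : MemLp f (ENNReal.ofReal p)) : Integrable fun u => ψ u * f u := by
  have hpq := Real.HolderConjugate.conjExponent hp
  have hψq : MemLp ψ (ENNReal.ofReal p.conjExponent) := by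
    refine ((memLp_envelope hθ hpq.symm.lt).const_mul B).mono hψm (.of_forall fun u => ?_)
    rw [Real.norm_eq_abs]
    exact (hψ u).trans (le_abs_self _)
  have := hpq.symm.ennrealOfReal
  exact hψq.integrable_mul hf

lemma lintegral_envelope_mul_lt_top {f : ℝ → ℝ} {θ p : ℝ} (hθ : 1 < θ) (hp : 1 < p)
    (hf : MemLp f (ENNReal.ofReal p)) (x : ℝ) :
    ∫⁻ v, ENNReal.ofReal (envelope θ v) * ‖f (x + v)‖ₑ < ⊤ := by
  have h := integrable_mul_of_le_envelope (ψ := envelope θ) (B := 1) hθ hp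
    (continuous_envelope θ).aestronglyMeasurable
    (fun u => by rw [abs_of_nonneg (envelope_nonneg _ _), one_mul])
    (hf.comp_measurePreserving (measurePreserving_add_left volume x))
  convert h.hasFiniteIntegral.lt_top using 2 with v
  simp [enorm_mul, Real.enorm_of_nonneg (envelope_nonneg _ _)]

/-- The double kernel `∑_k |φ(x - k)| |ψ(u - k)|` is dominated by an envelope in `u - x`, in the
integrated form in which it is applied. -/
lemma exists_kernel_bound {φ ψ : ℝ → ℝ} {A B θ : ℝ} (hθ : 1 < θ)
    (hφ : ∀ u, |φ u| ≤ A * envelope θ u) (hψ : ∀ u, |ψ u| ≤ B * envelope θ u) :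
    ∃ K : ℝ≥0∞, K ≠ ⊤ ∧ ∀ (x : ℝ) (G : ℝ → ℝ≥0∞), AEMeasurable G →
      ∑' k : ℤ, ‖φ (x - k)‖ₑ * ∫⁻ u, ‖ψ (u - k)‖ₑ * G u ≤
        K * ∫⁻ v, ENNReal.ofReal (envelope θ v) * G (x + v) := by
  obtain ⟨K, hK0, hK⟩ := exists_tsum_envelope_mul_le hθ
  have hA : 0 ≤ A := nonneg_of_mul_nonneg_left ((abs_nonneg _).trans (hφ 0)) (envelope_pos _ _)
  have hB : 0 ≤ B := nonneg_of_mul_nonneg_left ((abs_nonneg _).trans (hψ 0)) (envelope_pos _ _)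
  refine ⟨ENNReal.ofReal (A * B) * ENNReal.ofReal K, by finiteness, fun x G hG => ?_⟩
  have hφe : ∀ u, ‖φ u‖ₑ ≤ ENNReal.ofReal (A * envelope θ u) := fun u => by
    rw [Real.enorm_eq_ofReal_abs]; exact ENNReal.ofReal_le_ofReal (hφ u)
  have hψe : ∀ u, ‖ψ u‖ₑ ≤ ENNReal.ofReal (B * envelope θ u) := fun u => by
    rw [Real.enorm_eq_ofReal_abs]; exact ENNReal.ofReal_le_ofReal (hψ u)
  have hcont : ∀ k : ℤ, Measurable fun u : ℝ =>
      ENNReal.ofReal (envelope θ (x - k) * envelope θ (u - k)) := fun k =>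
    (((continuous_envelope θ).measurable.comp (measurable_id.sub_const _)).const_mul
      _).ennreal_ofReal
  have hAB : ∀ (k : ℤ) (u : ℝ), ENNReal.ofReal (A * envelope θ (x - k)) *
      ENNReal.ofReal (B * envelope θ (u - k)) =
      ENNReal.ofReal (A * B) * ENNReal.ofReal (envelope θ (x - k) * envelope θ (u - k)) := by
    intro k u
    rw [← ENNReal.ofReal_mul (mul_nonneg hA (envelope_nonneg _ _)),
      ← ENNReal.ofReal_mul (mul_nonneg hA hB)]
    congr 1; ring
  calc ∑' k : ℤ, ‖φ (x - k)‖ₑ * ∫⁻ u, ‖ψ (u - k)‖ₑ * G u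
      ≤ ∑' k : ℤ, ∫⁻ u, ENNReal.ofReal (A * B) *
          ENNReal.ofReal (envelope θ (x - k) * envelope θ (u - k)) * G u := by
        refine ENNReal.tsum_le_tsum fun k => (lintegral_const_mul_le _ _).trans ?_
        refine lintegral_mono fun u => ?_
        rw [← hAB, ← mul_assoc]
        gcongr
        exacts [hφe _, hψe _]
    _ = ∫⁻ u, ENNReal.ofReal (A * B) *
          (∑' k : ℤ, ENNReal.ofReal (envelope θ (x - k) * envelope θ (u - k))) * G u := by
        have hm : ∀ k : ℤ, AEMeasurable fun u => ENNReal.ofReal (A * B) *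
            ENNReal.ofReal (envelope θ (x - k) * envelope θ (u - k)) * G u := fun k =>
          ((hcont k).const_mul _).aemeasurable.mul hG
        rw [← lintegral_tsum hm]
        simp only [ENNReal.tsum_mul_right, ENNReal.tsum_mul_left]
    _ ≤ ∫⁻ u, ENNReal.ofReal (A * B) * ENNReal.ofReal K *
          (ENNReal.ofReal (envelope θ (u - x)) * G u) := by
        refine lintegral_mono fun u => ?_
        rw [← mul_assoc, mul_assoc (ENNReal.ofReal (A * B)) (ENNReal.ofReal K),
          ← ENNReal.ofReal_mul hK0.le]
        gcongr
        exact hK x u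
    _ = _ := by
        rw [lintegral_const_mul' _ _ (by finiteness),
          ← lintegral_add_left_eq_self
            (fun u => ENNReal.ofReal (envelope θ (u - x)) * G u) x]
        simp only [add_sub_cancel_left]

/-- The operator `D_w` at the scale `w = 1`. -/
noncomputable def unitOperator (φ ψ f : ℝ → ℝ) (x : ℝ) : ℝ :=
  ∑' k : ℤ, φ (x - k) * ∫ u, ψ (u - k) * f u

/-- The hypotheses on the pair of kernels that boundedness of the operator rests on: measurability
and domination by a common integrable envelope. -/
structure KernelPair (φ ψ : ℝ → ℝ) (A B θ : ℝ) : Prop where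
  one_lt : 1 < θ
  meas_left : AEStronglyMeasurable φ
  meas_right : AEStronglyMeasurable ψ
  le_left : ∀ u, |φ u| ≤ A * envelope θ u
  le_right : ∀ u, |ψ u| ≤ B * envelope θ u

variable {φ ψ : ℝ → ℝ} {A B θ p : ℝ}

lemma KernelPair.integrable (h : KernelPair φ ψ A B θ) (hp : 1 < p) {f : ℝ → ℝ}
    (hf : MemLp f (ENNReal.ofReal p)) (k : ℤ) : Integrable fun u => ψ (u - k) * f u := by
  have h1 := integrable_mul_of_le_envelope h.one_lt hp h.meas_right h.le_right
    (hf.comp_measurePreserving (measurePreserving_add_right volume (k : ℝ)))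
  simpa using h1.comp_sub_right (k : ℝ)

lemma enorm_integral_mul_le (ψ f : ℝ → ℝ) :
    ‖∫ u, ψ u * f u‖ₑ ≤ ∫⁻ u, ‖ψ u‖ₑ * ‖f u‖ₑ := by
  simpa only [enorm_mul] using enorm_integral_le_lintegral_enorm fun u => ψ u * f u

/-- Domination of the terms of the series defining the operator. -/
lemma KernelPair.exists_tsum_enorm_le (h : KernelPair φ ψ A B θ) :
    ∃ K : ℝ≥0∞, K ≠ ⊤ ∧ ∀ (x : ℝ) (f : ℝ → ℝ), AEStronglyMeasurable f →
      ∑' k : ℤ, ‖φ (x - k) * ∫ u, ψ (u - k) * f u‖ₑ ≤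
        K * ∫⁻ v, ENNReal.ofReal (envelope θ v) * ‖f (x + v)‖ₑ := by
  obtain ⟨K, hK, h'⟩ := exists_kernel_bound h.one_lt h.le_left h.le_right
  refine ⟨K, hK, fun x f hf => le_trans ?_ (h' x _ hf.enorm)⟩
  refine ENNReal.tsum_le_tsum fun k => ?_
  rw [enorm_mul]
  gcongr
  exact enorm_integral_mul_le _ _

lemma KernelPair.summable (h : KernelPair φ ψ A B θ) (hp : 1 < p) {f : ℝ → ℝ}
    (hf : MemLp f (ENNReal.ofReal p)) (x : ℝ) :
    Summable fun k : ℤ => φ (x - k) * ∫ u, ψ (u - k) * f u := by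
  obtain ⟨K, hK, h'⟩ := h.exists_tsum_enorm_le
  refine (tsum_enorm_ne_top_iff_summable_norm.1 (ne_top_of_le_ne_top ?_ (h' x f hf.1))).of_norm
  exact ENNReal.mul_ne_top hK (lintegral_envelope_mul_lt_top h.one_lt hp hf x).ne

lemma KernelPair.aestronglyMeasurable (h : KernelPair φ ψ A B θ) (hp : 1 < p) {f : ℝ → ℝ}
    (hf : MemLp f (ENNReal.ofReal p)) : AEStronglyMeasurable (unitOperator φ ψ f) := by
  refine aestronglyMeasurable_of_tendsto_ae (atTop : Filter (Finset ℤ))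
    (f := fun s x => ∑ k ∈ s, φ (x - k) * ∫ u, ψ (u - k) * f u) (fun s => ?_)
    (.of_forall fun x => (h.summable hp hf x).hasSum)
  refine Finset.aestronglyMeasurable_fun_sum s fun k _ => AEStronglyMeasurable.mul_const ?_ _
  exact h.meas_left.comp_measurePreserving (measurePreserving_sub_right volume (k : ℝ))

lemma KernelPair.unitOperator_sub (h : KernelPair φ ψ A B θ) (hp : 1 < p) {f g : ℝ → ℝ}
    (hf : MemLp f (ENNReal.ofReal p)) (hg : MemLp g (ENNReal.ofReal p)) (x : ℝ) :
    unitOperator φ ψ (f - g) x = unitOperator φ ψ f x - unitOperator φ ψ g x := by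
  unfold unitOperator
  rw [← (h.summable hp hf x).tsum_sub (h.summable hp hg x)]
  refine tsum_congr fun k => ?_
  rw [← mul_sub, ← integral_sub (h.integrable hp hf k) (h.integrable hp hg k)]
  simp only [Pi.sub_apply, mul_sub]

/-- The weight `w(v) dv`, for a nonnegative function `w`. -/
noncomputable def weightMeasure (w : ℝ → ℝ) : Measure ℝ :=
  volume.withDensity fun v => ENNReal.ofReal (w v)

lemma lintegral_weightMeasure {w : ℝ → ℝ} (hw : Continuous w) {G : ℝ → ℝ≥0∞} (hG : Measurable G) :
    ∫⁻ v, G v ∂weightMeasure w = ∫⁻ v, ENNReal.ofReal (w v) * G v := by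
  unfold weightMeasure
  rw [lintegral_withDensity_eq_lintegral_mul _ hw.measurable.ennreal_ofReal hG]
  rfl

lemma weightMeasure_envelope_lt_top {θ : ℝ} (hθ : 1 < θ) :
    weightMeasure (envelope θ) Set.univ < ⊤ := by
  unfold weightMeasure
  rw [withDensity_apply _ MeasurableSet.univ, setLIntegral_univ]
  exact lintegral_envelope_lt_top hθ

instance (w : ℝ → ℝ) : SFinite (weightMeasure w) := by
  unfold weightMeasure; infer_instance

/-- The operator is bounded on `L^p`. -/
lemma KernelPair.exists_eLpNorm_le (h : KernelPair φ ψ A B θ) (hp : 1 < p) :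
    ∃ C : ℝ≥0∞, C ≠ ⊤ ∧ ∀ f : ℝ → ℝ, MemLp f (ENNReal.ofReal p) →
      eLpNorm (unitOperator φ ψ f) (ENNReal.ofReal p) ≤ C * eLpNorm f (ENNReal.ofReal p) := by
  obtain ⟨K, hK, h'⟩ := h.exists_tsum_enorm_le
  refine ⟨K * weightMeasure (envelope θ) Set.univ,
    ENNReal.mul_ne_top hK (weightMeasure_envelope_lt_top h.one_lt).ne, fun f hf => ?_⟩
  obtain ⟨f', hf'm, hff'⟩ := hf.1
  have hf' : Measurable f' := hf'm.measurable
  have hpt : ∀ x, ‖unitOperator φ ψ f x‖ₑ ≤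
      ∫⁻ v, ‖f' (x + v)‖ₑ ∂(K • weightMeasure (envelope θ)) := by
    intro x
    have hae : (fun v => f (x + v)) =ᵐ[volume] fun v => f' (x + v) :=
      (measurePreserving_add_left volume x).quasiMeasurePreserving.ae_eq_comp hff'
    have hm : Measurable fun v => ‖f' (x + v)‖ₑ := (hf'.comp (measurable_const_add x)).enorm
    rw [lintegral_smul_measure, lintegral_weightMeasure (continuous_envelope θ) hm]
    refine (enorm_tsum_le_tsum_enorm.trans (h' x f hf.1)).trans_eq ?_
    rw [smul_eq_mul]
    congr 1
    refine lintegral_congr_ae ?_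
    filter_upwards [hae] with v hv
    rw [hv]
  have := eLpNorm_le_of_enorm_le_lintegral hp (G := fun x v => f' (x + v))
    (hf'.comp measurable_add) hpt (A := eLpNorm f (ENNReal.ofReal p))
    (.of_forall fun v => by
      rw [eLpNorm_comp_add_right hf'.aestronglyMeasurable, eLpNorm_congr_ae hff'])
  simpa using this

lemma KernelPair.memLp (h : KernelPair φ ψ A B θ) (hp : 1 < p) {f : ℝ → ℝ}
    (hf : MemLp f (ENNReal.ofReal p)) : MemLp (unitOperator φ ψ f) (ENNReal.ofReal p) := by
  obtain ⟨C, hC, h'⟩ := h.exists_eLpNorm_le hp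
  exact ⟨h.aestronglyMeasurable hp hf,
    (h' f hf).trans_lt (ENNReal.mul_lt_top hC.lt_top hf.2)⟩

end

/-! ### Polynomial reproduction and the Taylor remainder -/

section

variable {φ ψ : ℝ → ℝ} {A B θ p : ℝ}

lemma KernelPair.integrable_pow_mul (h : KernelPair φ ψ A B θ) {n : ℕ} (hn : (n : ℝ) + 1 < θ) :
    Integrable fun v => v ^ n * ψ v := by
  have hB : 0 ≤ B :=
    nonneg_of_mul_nonneg_left ((abs_nonneg _).trans (h.le_right 0)) (envelope_pos _ _)
  refine ((integrable_envelope (θ := θ - n) (by linarith)).const_mul B).mono'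
    ((continuous_pow n).aestronglyMeasurable.mul h.meas_right) (.of_forall fun v => ?_)
  rw [Real.norm_eq_abs, abs_mul, abs_pow]
  calc |v| ^ n * |ψ v| ≤ |v| ^ n * (B * envelope θ v) := by gcongr; exact h.le_right v
    _ = B * (envelope θ v * |v| ^ n) := by ring
    _ ≤ _ := by gcongr; exact envelope_mul_pow_le θ n v

lemma KernelPair.hasSum_discreteMoment (h : KernelPair φ ψ A B θ) {n : ℕ} (hn : (n : ℝ) + 1 < θ)
    (x : ℝ) : HasSum (fun k : ℤ => φ (x - k) * ((k : ℝ) - x) ^ n) (discreteMoment φ n x) := by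
  have hA : 0 ≤ A :=
    nonneg_of_mul_nonneg_left ((abs_nonneg _).trans (h.le_left 0)) (envelope_pos _ _)
  obtain ⟨S, -, hS⟩ := exists_tsum_envelope_le (θ := θ - n) (by linarith)
  refine Summable.hasSum (Summable.of_norm_bounded ((hS x).1.mul_left A) fun k => ?_)
  rw [Real.norm_eq_abs, abs_mul, abs_pow, abs_sub_comm]
  calc |φ (x - k)| * |x - k| ^ n ≤ (A * envelope θ (x - k)) * |x - k| ^ n := by
        gcongr; exact h.le_left _
    _ = A * (envelope θ (x - k) * |x - k| ^ n) := by ring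
    _ ≤ _ := by gcongr; exact envelope_mul_pow_le θ n _

/-- Binomial expansion of a shifted moment of `ψ` about the integer `k`. -/
lemma integral_shift_mul_pow_eq (x : ℝ) (k : ℤ) (i : ℕ)
    (hint : ∀ n ≤ i, Integrable fun v => v ^ n * ψ v) :
    (Integrable fun u => ψ (u - k) * (u - x) ^ i) ∧
    ∫ u, ψ (u - k) * (u - x) ^ i =
      ∑ n ∈ Finset.range (i + 1),
        (i.choose n : ℝ) * ((k : ℝ) - x) ^ (i - n) * continuousMoment ψ n := by
  have hexp : ∀ v : ℝ, ψ v * (v + ((k : ℝ) - x)) ^ i = ∑ n ∈ Finset.range (i + 1),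
      (i.choose n : ℝ) * ((k : ℝ) - x) ^ (i - n) * (v ^ n * ψ v) := by
    intro v
    rw [add_pow, Finset.mul_sum]
    exact Finset.sum_congr rfl fun n _ => by ring
  have hi : ∀ n ∈ Finset.range (i + 1), Integrable fun v : ℝ =>
      (i.choose n : ℝ) * ((k : ℝ) - x) ^ (i - n) * (v ^ n * ψ v) := fun n hn =>
    (hint n (Finset.mem_range_succ_iff.1 hn)).const_mul _
  have hshift : (fun u : ℝ => ψ (u - k) * (u - x) ^ i) =
      fun u => (fun v => ψ v * (v + ((k : ℝ) - x)) ^ i) (u - k) := by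
    funext u
    simp
  rw [hshift, integral_sub_right_eq_self (fun v => ψ v * (v + ((k : ℝ) - x)) ^ i) (k : ℝ)]
  simp only [hexp]
  refine ⟨(integrable_finsetSum _ hi).comp_sub_right (k : ℝ), ?_⟩
  rw [integral_finsetSum _ hi]
  simp only [integral_const_mul, continuousMoment]

/-- Polynomial reproduction: the operator maps `(u - x)^i`, `i < r`, to a function whose value at
`x` is `1` for `i = 0` and `0` otherwise. -/
lemma KernelPair.hasSum_integral_pow (h : KernelPair φ ψ A B θ) {r : ℕ} (hr : (r : ℝ) + 1 < θ)
    (hφ0 : ∀ u, discreteMoment φ 0 u = 1) (hψ0 : continuousMoment ψ 0 = 1)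
    (hv : VanishingMoments φ ψ r) (x : ℝ) {i : ℕ} (hi : i < r) :
    HasSum (fun k : ℤ => φ (x - k) * ∫ u, ψ (u - k) * (u - x) ^ i) (if i = 0 then 1 else 0) := by
  have hlt : ∀ n ≤ i, (n : ℝ) + 1 < θ := fun n hn => by
    have : (n : ℝ) ≤ r := by exact_mod_cast hn.trans hi.le
    linarith
  have hval : ∑ n ∈ Finset.range (i + 1),
      (i.choose n : ℝ) * discreteMoment φ (i - n) x * continuousMoment ψ n =
        if i = 0 then 1 else 0 := by
    split_ifs with h0
    · subst h0; simp [hφ0, hψ0]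
    · exact hv i (by omega) (by omega) x
  rw [← hval]
  have hs := hasSum_sum (s := Finset.range (i + 1)) fun n _ =>
    ((h.hasSum_discreteMoment (hlt (i - n) (Nat.sub_le _ _)) x).mul_left (i.choose n : ℝ)).mul_right
      (continuousMoment ψ n)
  refine hs.congr_fun fun k => ?_
  rw [(integral_shift_mul_pow_eq x k i fun n hn => h.integrable_pow_mul (hlt n hn)).2,
    Finset.mul_sum]
  exact Finset.sum_congr rfl fun n _ => by ring

/-- The remainder of the Taylor polynomial of degree less than `r` at `x`, for a chain `H` of
successive derivatives. -/
noncomputable def taylorRemainder (r : ℕ) (H : ℕ → ℝ → ℝ) (x u : ℝ) : ℝ :=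
  H 0 u - ∑ i ∈ Finset.range r, H i x / (i.factorial : ℝ) * (u - x) ^ i

/-- Integral form of the Taylor remainder, with the weight `r (1 - s)^(r-1) / r!` bounded by `1`. -/
lemma enorm_taylorRemainder_le {r : ℕ} (hr : r ≠ 0) {H : ℕ → ℝ → ℝ}
    (hH : ∀ i < r, ∀ x, HasDerivAt (H i) (H (i + 1) x) x) (hc : Continuous (H r)) (x u : ℝ) :
    ‖taylorRemainder r H x u‖ₑ ≤
      ENNReal.ofReal (|u - x| ^ r) * ∫⁻ s in Set.Icc (0 : ℝ) 1, ‖H r (x + s * (u - x))‖ₑ := by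
  set v := u - x with hv
  -- the Taylor polynomial of `H 0` for the target `u`, with base point moving from `x` to `u`
  set P : ℝ → ℝ := fun s => ∑ i ∈ Finset.range r,
    H i (x + s * v) * ((1 - s) ^ i * (v ^ i / (i.factorial : ℝ))) with hP
  set b : ℕ → ℝ → ℝ := fun i s =>
    i * H i (x + s * v) * (1 - s) ^ (i - 1) * (v ^ i / (i.factorial : ℝ)) with hb
  have hderiv : ∀ s, HasDerivAt P (b r s) s := by
    intro s
    -- differentiating `P` gives a telescoping sum
    have hsum : b r s = ∑ i ∈ Finset.range r, (b (i + 1) s - b i s) := by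
      rw [Finset.sum_range_sub fun i => b i s]; simp [hb]
    rw [hsum, hP]
    refine HasDerivAt.fun_sum fun i hi => ?_
    have h1 : HasDerivAt (fun s => x + s * v) v s := by
      simpa using ((hasDerivAt_id s).mul_const v).const_add x
    have h2 := (hH i (Finset.mem_range.1 hi) (x + s * v)).comp s h1
    have h3 : HasDerivAt (fun s : ℝ => (1 - s) ^ i) (i * (1 - s) ^ (i - 1) * (-1)) s :=
      ((hasDerivAt_id s).const_sub 1).pow i
    refine (h2.mul (h3.mul_const (v ^ i / (i.factorial : ℝ)))).congr_deriv ?_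
    simp only [hb, Function.comp_apply, Nat.add_sub_cancel, Nat.factorial_succ]
    have hf : (i.factorial : ℝ) ≠ 0 := by positivity
    have hi1 : (i : ℝ) + 1 ≠ 0 := by positivity
    push_cast
    field_simp
    ring
  have hbc : Continuous (b r) := by
    simp only [hb]
    have : Continuous fun s => H r (x + s * v) := hc.comp (by fun_prop)
    fun_prop
  have hFTC : taylorRemainder r H x u = ∫ s in (0 : ℝ)..1, b r s := by
    rw [intervalIntegral.integral_eq_sub_of_hasDerivAt (fun s _ => hderiv s)
      (hbc.intervalIntegrable _ _)]
    unfold taylorRemainder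
    congr 1
    · obtain ⟨n, rfl⟩ := Nat.exists_eq_succ_of_ne_zero hr
      simp [hP, Finset.sum_range_succ', hv]
    · simp only [hP, zero_mul, add_zero, sub_zero, one_pow, one_mul]
      exact Finset.sum_congr rfl fun i _ => by rw [← hv]; ring
  have hfac : (r : ℝ) / (r.factorial : ℝ) ≤ 1 := by
    rw [div_le_one (by positivity)]
    exact_mod_cast Nat.self_le_factorial r
  have hbound : ∀ s ∈ Set.Icc (0 : ℝ) 1,
      ‖b r s‖ₑ ≤ ENNReal.ofReal (|v| ^ r) * ‖H r (x + s * v)‖ₑ := by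
    intro s hs
    rw [Real.enorm_eq_ofReal_abs, Real.enorm_eq_ofReal_abs, ← ENNReal.ofReal_mul (by positivity)]
    refine ENNReal.ofReal_le_ofReal ?_
    have h1 : |1 - s| ^ (r - 1) ≤ 1 :=
      pow_le_one₀ (abs_nonneg _) (by rw [abs_le]; constructor <;> linarith [hs.1, hs.2])
    simp only [hb, abs_mul, abs_div, abs_pow, Nat.abs_cast]
    calc (r : ℝ) * |H r (x + s * v)| * |1 - s| ^ (r - 1) * (|v| ^ r / (r.factorial : ℝ))
        = (r / (r.factorial : ℝ)) * |1 - s| ^ (r - 1) * (|v| ^ r * |H r (x + s * v)|) := by ring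
      _ ≤ 1 * 1 * (|v| ^ r * |H r (x + s * v)|) := by gcongr
      _ = _ := by ring
  rw [hFTC, intervalIntegral.integral_of_le zero_le_one]
  calc _ ≤ ∫⁻ s in Set.Ioc (0 : ℝ) 1, ‖b r s‖ₑ := enorm_integral_le_lintegral_enorm _
    _ ≤ ∫⁻ s in Set.Icc (0 : ℝ) 1, ‖b r s‖ₑ := lintegral_mono_set Set.Ioc_subset_Icc_self
    _ ≤ ∫⁻ s in Set.Icc (0 : ℝ) 1, ENNReal.ofReal (|v| ^ r) * ‖H r (x + s * v)‖ₑ :=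
        setLIntegral_mono' measurableSet_Icc hbound
    _ = _ := lintegral_const_mul' _ _ (by finiteness)

/-- By polynomial reproduction the error at `x` is the operator applied to the Taylor remainder. -/
lemma KernelPair.hasSum_taylorRemainder (h : KernelPair φ ψ A B θ) (hp : 1 < p) {r : ℕ}
    (hr0 : r ≠ 0) (hr : (r : ℝ) + 1 < θ)
    (hφ0 : ∀ u, discreteMoment φ 0 u = 1) (hψ0 : continuousMoment ψ 0 = 1)
    (hv : VanishingMoments φ ψ r) {H : ℕ → ℝ → ℝ} (hf : MemLp (H 0) (ENNReal.ofReal p)) (x : ℝ) :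
    HasSum (fun k : ℤ => φ (x - k) * ∫ u, ψ (u - k) * taylorRemainder r H x u)
      (unitOperator φ ψ (H 0) x - H 0 x) := by
  have hpoly := hasSum_sum (s := Finset.range r) fun i hi =>
    (h.hasSum_integral_pow hr hφ0 hψ0 hv x (Finset.mem_range.1 hi)).mul_left
      (H i x / (i.factorial : ℝ))
  have hval : ∑ i ∈ Finset.range r, H i x / (i.factorial : ℝ) * (if i = 0 then 1 else 0) =
      H 0 x := by
    simp [Nat.pos_of_ne_zero hr0]
  rw [hval] at hpoly
  refine ((h.summable hp hf x).hasSum.sub hpoly).congr_fun fun k => ?_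
  have hi : ∀ i ∈ Finset.range r, Integrable fun u =>
      H i x / (i.factorial : ℝ) * (ψ (u - k) * (u - x) ^ i) := fun i hi => by
    refine ((integral_shift_mul_pow_eq x k i fun n hn => h.integrable_pow_mul ?_).1).const_mul _
    have : (n : ℝ) ≤ r := by exact_mod_cast hn.trans (Finset.mem_range.1 hi).le
    linarith
  have hsplit : ∀ u, ψ (u - k) * taylorRemainder r H x u = ψ (u - k) * H 0 u -
      ∑ i ∈ Finset.range r, H i x / (i.factorial : ℝ) * (ψ (u - k) * (u - x) ^ i) := by
    intro u
    rw [taylorRemainder, mul_sub, Finset.mul_sum]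
    congr 1
    exact Finset.sum_congr rfl fun i _ => by ring
  simp only [hsplit]
  rw [integral_sub (h.integrable hp hf k) (integrable_finsetSum _ hi), integral_finsetSum _ hi,
    mul_sub, Finset.mul_sum]
  congr 1
  exact Finset.sum_congr rfl fun i _ => by rw [integral_const_mul]; ring

/-- Pointwise bound of the error by an average of translates of the `r`-th derivative. -/
lemma KernelPair.exists_enorm_sub_le (h : KernelPair φ ψ A B θ) (hp : 1 < p) {r : ℕ}
    (hr0 : r ≠ 0) (hr : (r : ℝ) + 1 < θ)
    (hφ0 : ∀ u, discreteMoment φ 0 u = 1) (hψ0 : continuousMoment ψ 0 = 1)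
    (hv : VanishingMoments φ ψ r) :
    ∃ K : ℝ≥0∞, K ≠ ⊤ ∧ ∀ H : ℕ → ℝ → ℝ, (∀ i < r, ∀ x, HasDerivAt (H i) (H (i + 1) x) x) →
      Continuous (H r) → MemLp (H 0) (ENNReal.ofReal p) → ∀ x,
      ‖unitOperator φ ψ (H 0) x - H 0 x‖ₑ ≤ K * ∫⁻ v, ENNReal.ofReal (envelope (θ - r) v) *
        ∫⁻ s in Set.Icc (0 : ℝ) 1, ‖H r (x + s * v)‖ₑ := by
  obtain ⟨K, hK, hker⟩ := exists_kernel_bound h.one_lt h.le_left h.le_right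
  refine ⟨K, hK, fun H hH hc hf x => ?_⟩
  have hcm : Measurable fun z : ℝ × ℝ => ‖H r (x + z.2 * z.1)‖ₑ :=
    (hc.comp (by fun_prop : Continuous fun z : ℝ × ℝ => x + z.2 * z.1)).measurable.enorm
  have hm : Measurable fun v : ℝ => ∫⁻ s in Set.Icc (0 : ℝ) 1, ‖H r (x + s * v)‖ₑ :=
    hcm.lintegral_prod_right'
  have hGm : Measurable fun u : ℝ => ENNReal.ofReal (|u - x| ^ r) *
      ∫⁻ s in Set.Icc (0 : ℝ) 1, ‖H r (x + s * (u - x))‖ₑ :=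
    (by fun_prop : Measurable fun u : ℝ => ENNReal.ofReal (|u - x| ^ r)).mul
      (hm.comp (measurable_id.sub_const x))
  rw [← (h.hasSum_taylorRemainder hp hr0 hr hφ0 hψ0 hv hf x).tsum_eq]
  refine enorm_tsum_le_tsum_enorm.trans (le_trans (ENNReal.tsum_le_tsum fun k => ?_)
    ((hker x _ hGm.aemeasurable).trans (mul_le_mul_right (lintegral_mono fun v => ?_) K)))
  · rw [enorm_mul]
    refine mul_le_mul_right ((enorm_integral_mul_le _ _).trans (lintegral_mono fun u => ?_)) _
    exact mul_le_mul_right (enorm_taylorRemainder_le hr0 hH hc x u) _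
  · simp only [add_sub_cancel_left]
    rw [← mul_assoc, ← ENNReal.ofReal_mul (envelope_nonneg _ _)]
    exact mul_le_mul_left (ENNReal.ofReal_le_ofReal (envelope_mul_pow_le θ r v)) _

/-- Jackson-type estimate for smooth functions: the error is controlled by the `r`-th derivative. -/
lemma KernelPair.exists_eLpNorm_sub_le (h : KernelPair φ ψ A B θ) (hp : 1 < p) {r : ℕ}
    (hr0 : r ≠ 0) (hr : (r : ℝ) + 1 < θ)
    (hφ0 : ∀ u, discreteMoment φ 0 u = 1) (hψ0 : continuousMoment ψ 0 = 1)
    (hv : VanishingMoments φ ψ r) :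
    ∃ C : ℝ≥0∞, C ≠ ⊤ ∧ ∀ H : ℕ → ℝ → ℝ, (∀ i < r, ∀ x, HasDerivAt (H i) (H (i + 1) x) x) →
      Continuous (H r) → MemLp (H 0) (ENNReal.ofReal p) →
      eLpNorm (unitOperator φ ψ (H 0) - H 0) (ENNReal.ofReal p) ≤
        C * eLpNorm (H r) (ENNReal.ofReal p) := by
  obtain ⟨K, hK, hpt⟩ := h.exists_enorm_sub_le hp hr0 hr hφ0 hψ0 hv
  refine ⟨(K • weightMeasure (envelope (θ - r))).prod
    (volume.restrict (Set.Icc (0 : ℝ) 1)) Set.univ, ?_, fun H hH hc hf => ?_⟩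
  · rw [← Set.univ_prod_univ, Measure.prod_prod]
    simpa using ENNReal.mul_ne_top hK
      (weightMeasure_envelope_lt_top (θ := θ - r) (by linarith)).ne
  have hcm : Measurable fun z : ℝ × (ℝ × ℝ) => H r (z.1 + z.2.2 * z.2.1) :=
    (hc.comp (by fun_prop : Continuous fun z : ℝ × (ℝ × ℝ) => z.1 + z.2.2 * z.2.1)).measurable
  refine eLpNorm_le_of_enorm_le_lintegral hp (G := fun x z => H r (x + z.2 * z.1)) hcm
    (fun x => ?_) (.of_forall fun z => ?_)
  swap
  · exact (eLpNorm_comp_add_right hc.aestronglyMeasurable (z.2 * z.1)).le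
  have hm2 : Measurable fun z : ℝ × ℝ => ‖H r (x + z.2 * z.1)‖ₑ :=
    (hcm.comp measurable_prodMk_left).enorm
  have hm1 : Measurable fun v : ℝ => ∫⁻ s in Set.Icc (0 : ℝ) 1, ‖H r (x + s * v)‖ₑ :=
    hm2.lintegral_prod_right'
  rw [lintegral_prod _ hm2.aemeasurable, lintegral_smul_measure,
    lintegral_weightMeasure (continuous_envelope _) hm1]
  exact hpt H hH hc hf x

end

/-! ### Smoothing by Steklov means -/

/-- The moving integral `x ↦ ∫_x^{x+a} g`, the unnormalised Steklov mean. -/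
noncomputable def movingIntegral (a : ℝ) (g : ℝ → ℝ) (x : ℝ) : ℝ := ∫ y in x..(x + a), g y

lemma hasDerivAt_movingIntegral (a : ℝ) {g : ℝ → ℝ} (hg : Continuous g) (x : ℝ) :
    HasDerivAt (movingIntegral a g) (fwdDiff a g x) x := by
  have hsplit : movingIntegral a g = fun x =>
      (∫ y in (0 : ℝ)..(x + a), g y) - ∫ y in (0 : ℝ)..x, g y := by
    funext x
    exact (intervalIntegral.integral_interval_sub_left (hg.intervalIntegrable _ _)
      (hg.intervalIntegrable _ _)).symm
  have hder : ∀ z, HasDerivAt (fun x => ∫ y in (0 : ℝ)..x, g y) (g z) z := fun z =>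
    intervalIntegral.integral_hasDerivAt_right (hg.intervalIntegrable _ _)
      (hg.stronglyMeasurableAtFilter _ _) hg.continuousAt
  rw [hsplit]
  exact ((hder (x + a)).comp_add_const x a).sub (hder x)

lemma continuous_movingIntegral (a : ℝ) {g : ℝ → ℝ} (hg : Continuous g) :
    Continuous (movingIntegral a g) :=
  continuous_iff_continuousAt.2 fun x => (hasDerivAt_movingIntegral a hg x).continuousAt

lemma continuous_iterate_movingIntegral (a : ℝ) {g : ℝ → ℝ} (hg : Continuous g) (n : ℕ) :
    Continuous ((movingIntegral a)^[n] g) := by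
  induction n with
  | zero => exact hg
  | succ n ih =>
    rw [Function.iterate_succ_apply']
    exact continuous_movingIntegral a ih

lemma continuous_iterate_fwdDiff (a : ℝ) {g : ℝ → ℝ} (hg : Continuous g) (n : ℕ) :
    Continuous ((fwdDiff a)^[n] g) := by
  induction n with
  | zero => exact hg
  | succ n ih =>
    rw [Function.iterate_succ_apply']
    exact (ih.comp (continuous_add_const a)).sub ih

lemma hasDerivAt_iterate_fwdDiff (a : ℝ) {F F' : ℝ → ℝ} (hF : ∀ x, HasDerivAt F (F' x) x) (n : ℕ) :
    ∀ x, HasDerivAt ((fwdDiff a)^[n] F) ((fwdDiff a)^[n] F' x) x := by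
  induction n with
  | zero => exact hF
  | succ n ih =>
    intro x
    rw [Function.iterate_succ_apply', Function.iterate_succ_apply']
    exact ((ih (x + a)).comp_add_const x a).sub (ih x)

/-- The `r`-fold moving integral is `r` times differentiable; each derivative turns one moving
integral into a difference. -/
lemma hasDerivAt_fwdDiff_movingIntegral (a : ℝ) {f : ℝ → ℝ} (hf : Continuous f) {r i : ℕ}
    (hi : i < r) (x : ℝ) :
    HasDerivAt ((fwdDiff a)^[i] ((movingIntegral a)^[r - i] f))
      ((fwdDiff a)^[i + 1] ((movingIntegral a)^[r - (i + 1)] f) x) x := by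
  obtain ⟨n, hn⟩ : ∃ n, r - i = n + 1 := ⟨r - i - 1, by omega⟩
  have hn' : r - (i + 1) = n := by omega
  rw [hn, hn', Function.iterate_succ_apply', Function.iterate_succ_apply]
  exact hasDerivAt_iterate_fwdDiff a
    (hasDerivAt_movingIntegral a (continuous_iterate_movingIntegral a hf n)) i x

lemma finiteDiff_eq_iterate_fwdDiff (r : ℕ) (t : ℝ) (f : ℝ → ℝ) :
    finiteDiff r t f = (fwdDiff t)^[r] f := by
  funext x
  rw [fwdDiff_iter_eq_sum_shift, finiteDiff]
  refine Finset.sum_congr rfl fun j _ => ?_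
  simp only [zsmul_eq_mul, nsmul_eq_mul]
  push_cast
  ring

/-- The law of a sum of `n` independent uniform variables on `[0, 1]`, whose density for `n ≥ 1` is
the `B`-spline of order `n`. -/
noncomputable def splineMeasure : ℕ → Measure ℝ
  | 0 => Measure.dirac 0
  | n + 1 => (volume.restrict (Set.Icc (0 : ℝ) 1)).conv (splineMeasure n)

instance : IsProbabilityMeasure (volume.restrict (Set.Icc (0 : ℝ) 1)) := ⟨by simp⟩

instance isProbabilityMeasure_splineMeasure (n : ℕ) : IsProbabilityMeasure (splineMeasure n) := by
  induction n with
  | zero => unfold splineMeasure; infer_instance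
  | succ n ih => unfold splineMeasure; infer_instance

lemma ae_mem_Icc_splineMeasure (n : ℕ) : ∀ᵐ σ ∂splineMeasure n, σ ∈ Set.Icc (0 : ℝ) n := by
  induction n with
  | zero =>
    rw [splineMeasure]
    exact (ae_dirac_iff measurableSet_Icc).2 (by simp)
  | succ n ih =>
    rw [splineMeasure, Measure.conv]
    refine (ae_map_iff (measurable_add (M := ℝ)).aemeasurable measurableSet_Icc).2 ?_
    have h1 := Measure.quasiMeasurePreserving_fst (μ := volume.restrict (Set.Icc (0 : ℝ) 1))
      (ν := splineMeasure n) |>.ae (ae_restrict_mem measurableSet_Icc)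
    have h2 := Measure.quasiMeasurePreserving_snd (μ := volume.restrict (Set.Icc (0 : ℝ) 1))
      (ν := splineMeasure n) |>.ae ih
    filter_upwards [h1, h2] with z hz1 hz2
    simp only [Set.mem_Icc] at hz1 hz2 ⊢
    push_cast
    constructor <;> linarith [hz1.1, hz1.2, hz2.1, hz2.2]

lemma integrable_comp_of_bound {T : Type*} [TopologicalSpace T] [MeasurableSpace T]
    [OpensMeasurableSpace T] {μ : Measure T} [IsFiniteMeasure μ] {f : ℝ → ℝ} (hf : Continuous f)
    {M : ℝ} (hM : ∀ x, |f x| ≤ M) {g : T → ℝ} (hg : Continuous g) :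
    Integrable (fun t => f (g t)) μ :=
  Integrable.of_bound (hf.comp hg).measurable.aestronglyMeasurable M (.of_forall fun t => hM (g t))

/-- The `n`-fold moving integral of step `a`, written as a spline average. -/
lemma iterate_movingIntegral_eq (a : ℝ) {f : ℝ → ℝ} (hf : Continuous f) {M : ℝ}
    (hM : ∀ x, |f x| ≤ M) (n : ℕ) (x : ℝ) :
    (movingIntegral a)^[n] f x = a ^ n * ∫ σ, f (x + a * σ) ∂splineMeasure n := by
  induction n generalizing x with
  | zero => simp [splineMeasure]
  | succ n ih =>
    have hconv : ∫ σ, f (x + a * σ) ∂splineMeasure (n + 1) =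
        ∫ s in Set.Icc (0 : ℝ) 1, ∫ σ, f ((x + a * s) + a * σ) ∂splineMeasure n := by
      have hfc : Continuous fun σ => f (x + a * σ) := hf.comp (by fun_prop)
      rw [splineMeasure, Measure.conv, integral_map (measurable_add (M := ℝ)).aemeasurable
        hfc.measurable.aestronglyMeasurable, integral_prod _ (integrable_comp_of_bound hf hM
          (by fun_prop : Continuous fun z : ℝ × ℝ => x + a * (z.1 + z.2)))]
      simp only [mul_add, add_assoc]
    rw [Function.iterate_succ_apply', movingIntegral]
    simp only [ih]
    have hsub := intervalIntegral.smul_integral_comp_add_mul (a := 0) (b := 1)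
      (fun y => ∫ σ, f (y + a * σ) ∂splineMeasure n) a x
    rw [mul_zero, mul_one, add_zero, smul_eq_mul] at hsub
    rw [intervalIntegral.integral_const_mul, ← hsub, hconv,
      intervalIntegral.integral_of_le zero_le_one, integral_Icc_eq_integral_Ioc]
    ring

lemma eLpNorm_finiteDiff_le_modulus (r : ℕ) (f : ℝ → ℝ) {t δ : ℝ} (ht : |t| ≤ δ) (q : ℝ≥0∞) :
    eLpNorm (finiteDiff r t f) q ≤ modulus r f δ q :=
  le_iSup₂ (f := fun (t : ℝ) (_ : |t| ≤ δ) => eLpNorm (finiteDiff r t f) q volume) t ht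

lemma aestronglyMeasurable_finiteDiff {f : ℝ → ℝ} (hf : AEStronglyMeasurable f) (r : ℕ) (t : ℝ) :
    AEStronglyMeasurable (finiteDiff r t f) :=
  Finset.aestronglyMeasurable_fun_sum _ fun _ _ =>
    (hf.comp_measurePreserving (measurePreserving_add_right volume _)).const_mul _

lemma exists_modulus_le (r : ℕ) {q : ℝ≥0∞} (hq : 1 ≤ q) :
    ∃ C : ℝ≥0∞, C ≠ ⊤ ∧ ∀ (f : ℝ → ℝ) (δ : ℝ), AEStronglyMeasurable f →
      modulus r f δ q ≤ C * eLpNorm f q := by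
  refine ⟨∑ j ∈ Finset.range (r + 1), ‖(r.choose j : ℝ) * (-1) ^ (r - j)‖ₑ,
    ENNReal.sum_ne_top.2 fun _ _ => enorm_ne_top, fun f δ hf => iSup₂_le fun t _ => ?_⟩
  have hm : ∀ j : ℕ, AEStronglyMeasurable (fun x : ℝ => f (x + j * t)) := fun j =>
    hf.comp_measurePreserving (measurePreserving_add_right volume _)
  have heq : finiteDiff r t f = ∑ j ∈ Finset.range (r + 1),
      fun x => (r.choose j : ℝ) * (-1) ^ (r - j) * f (x + j * t) := by
    funext x
    simp [finiteDiff]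
  rw [heq, Finset.sum_mul]
  refine (eLpNorm_sum_le (fun j _ => (hm j).const_mul _) hq).trans (Finset.sum_le_sum fun j _ => ?_)
  refine (eLpNorm_const_smul ((r.choose j : ℝ) * (-1) ^ (r - j))
    (fun x : ℝ => f (x + j * t)) q volume).le.trans ?_
  rw [eLpNorm_comp_add_right hf]

lemma finiteDiff_add (r : ℕ) (t : ℝ) (f g : ℝ → ℝ) :
    finiteDiff r t (f + g) = finiteDiff r t f + finiteDiff r t g := by
  funext x
  simp [finiteDiff, mul_add, Finset.sum_add_distrib]

lemma modulus_add_le (r : ℕ) {q : ℝ≥0∞} (hq : 1 ≤ q) {f g : ℝ → ℝ}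
    (hf : AEStronglyMeasurable f) (hg : AEStronglyMeasurable g) (δ : ℝ) :
    modulus r (f + g) δ q ≤ modulus r f δ q + modulus r g δ q := by
  refine iSup₂_le fun t ht => ?_
  rw [finiteDiff_add]
  refine (eLpNorm_add_le (aestronglyMeasurable_finiteDiff hf r t)
    (aestronglyMeasurable_finiteDiff hg r t) hq).trans ?_
  gcongr
  exacts [eLpNorm_finiteDiff_le_modulus r f ht q, eLpNorm_finiteDiff_le_modulus r g ht q]

/-- The coefficient with which the Steklov mean of step `(j + 1) / r` enters the smoothing of a
function. -/
noncomputable def smoothingCoeff (r j : ℕ) : ℝ :=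
  -((-1) ^ r * ((r.choose (j + 1) : ℝ) * (-1) ^ (r - (j + 1)) * ((((j + 1 : ℕ) : ℝ) / r) ^ r)⁻¹))

/-- The chain of derivatives of the smoothing of `f`, which is the combination of the Steklov means
of steps `1/r, 2/r, …, 1` that differs from `f` by an average of `r`-th differences of `f`. -/
noncomputable def smoothing (r : ℕ) (f : ℝ → ℝ) (i : ℕ) (x : ℝ) : ℝ :=
  ∑ j ∈ Finset.range r, smoothingCoeff r j *
    (fwdDiff (((j + 1 : ℕ) : ℝ) / r))^[i] ((movingIntegral (((j + 1 : ℕ) : ℝ) / r))^[r - i] f) x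

lemma hasDerivAt_smoothing {r i : ℕ} (hi : i < r) {f : ℝ → ℝ} (hf : Continuous f) (x : ℝ) :
    HasDerivAt (smoothing r f i) (smoothing r f (i + 1) x) x :=
  HasDerivAt.fun_sum fun _ _ => (hasDerivAt_fwdDiff_movingIntegral _ hf hi x).const_mul _

lemma continuous_smoothing (r i : ℕ) {f : ℝ → ℝ} (hf : Continuous f) :
    Continuous (smoothing r f i) :=
  continuous_finsetSum _ fun _ _ => continuous_const.mul
    (continuous_iterate_fwdDiff _ (continuous_iterate_movingIntegral _ hf _) _)

/-- The smoothing differs from `f` by a spline average of differences: the term `j = 0` of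
`Δ^r_{σ/r} f` gives back `f`, the others give Steklov means of step `j/r`. -/
lemma sub_smoothing_eq {r : ℕ} (hr : r ≠ 0) {f : ℝ → ℝ} (hf : Continuous f) {M : ℝ}
    (hM : ∀ x, |f x| ≤ M) (x : ℝ) :
    f x - smoothing r f 0 x = (-1) ^ r * ∫ σ, finiteDiff r (σ / r) f x ∂splineMeasure r := by
  have hi : ∀ j ∈ Finset.range (r + 1), Integrable (fun σ : ℝ =>
      (r.choose j : ℝ) * (-1) ^ (r - j) * f (x + j * (σ / r))) (splineMeasure r) := fun j _ =>
    (integrable_comp_of_bound hf hM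
      (by fun_prop : Continuous fun σ : ℝ => x + j * (σ / r))).const_mul _
  have hr' : (r : ℝ) ≠ 0 := by exact_mod_cast hr
  have hsq : (-1 : ℝ) ^ r * (-1) ^ r = 1 := by rw [← mul_pow]; simp
  simp only [finiteDiff]
  rw [integral_finsetSum _ hi, Finset.sum_range_succ', mul_add, add_comm, sub_eq_add_neg]
  congr 1
  · simp [← mul_assoc, hsq]
  · rw [smoothing, ← Finset.sum_neg_distrib, Finset.mul_sum]
    refine Finset.sum_congr rfl fun j _ => ?_
    have ha : (((j + 1 : ℕ) : ℝ) / r) ^ r ≠ 0 := by positivity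
    have hcongr : ∀ σ : ℝ, x + ((j + 1 : ℕ) : ℝ) * (σ / r) = x + ((j + 1 : ℕ) : ℝ) / r * σ :=
      fun σ => by ring
    simp only [Function.iterate_zero, id, Nat.sub_zero, hcongr]
    rw [iterate_movingIntegral_eq _ hf hM, integral_const_mul, smoothingCoeff]
    field_simp

lemma eLpNorm_sub_smoothing_le {r : ℕ} (hr : r ≠ 0) {p : ℝ} (hp : 1 < p) {f : ℝ → ℝ}
    (hf : Continuous f) {M : ℝ} (hM : ∀ x, |f x| ≤ M) :
    eLpNorm (f - smoothing r f 0) (ENNReal.ofReal p) ≤ modulus r f 1 (ENNReal.ofReal p) := by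
  have hc : Continuous (Function.uncurry fun x σ : ℝ => finiteDiff r (σ / r) f x) := by
    unfold finiteDiff Function.uncurry
    fun_prop
  have h := eLpNorm_le_of_enorm_le_lintegral (μ := splineMeasure r) hp
    (g := f - smoothing r f 0) hc.measurable (fun x => ?_)
    (A := modulus r f 1 (ENNReal.ofReal p)) ?_
  · simpa using h
  · rw [Pi.sub_apply, sub_smoothing_eq hr hf hM, enorm_mul]
    simpa using enorm_integral_le_lintegral_enorm fun σ => finiteDiff r (σ / r) f x
  · filter_upwards [ae_mem_Icc_splineMeasure r] with σ hσ
    refine eLpNorm_finiteDiff_le_modulus r f ?_ _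
    rw [abs_of_nonneg (div_nonneg hσ.1 (Nat.cast_nonneg r))]
    exact div_le_one_of_le₀ hσ.2 (Nat.cast_nonneg r)

lemma eLpNorm_smoothing_le (r : ℕ) {q : ℝ≥0∞} (hq : 1 ≤ q) {f : ℝ → ℝ} (hf : Continuous f) :
    eLpNorm (smoothing r f r) q ≤
      (∑ j ∈ Finset.range r, ‖smoothingCoeff r j‖ₑ) * modulus r f 1 q := by
  have heq : smoothing r f r = ∑ j ∈ Finset.range r,
      smoothingCoeff r j • finiteDiff r (((j + 1 : ℕ) : ℝ) / r) f := by
    funext x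
    simp [smoothing, finiteDiff_eq_iterate_fwdDiff]
  rw [heq, Finset.sum_mul]
  refine (eLpNorm_sum_le (fun j _ => AEStronglyMeasurable.const_smul
    (aestronglyMeasurable_finiteDiff hf.aestronglyMeasurable _ _) _) hq).trans
    (Finset.sum_le_sum fun j hj => ?_)
  rw [eLpNorm_const_smul]
  gcongr
  refine eLpNorm_finiteDiff_le_modulus r f ?_ q
  rw [abs_of_nonneg (by positivity)]
  refine div_le_one_of_le₀ ?_ (Nat.cast_nonneg r)
  exact_mod_cast Finset.mem_range.1 hj

/-! ### The estimate at scale one, and dilations -/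

section

variable {φ ψ : ℝ → ℝ} {A B θ p : ℝ}

lemma KernelPair.eLpNorm_sub_le_add (h : KernelPair φ ψ A B θ) (hp : 1 < p) {f g : ℝ → ℝ}
    (hf : MemLp f (ENNReal.ofReal p)) (hg : MemLp g (ENNReal.ofReal p)) :
    eLpNorm (unitOperator φ ψ f - f) (ENNReal.ofReal p) ≤
      eLpNorm (unitOperator φ ψ (f - g)) (ENNReal.ofReal p) +
        eLpNorm (unitOperator φ ψ g - g) (ENNReal.ofReal p) +
        eLpNorm (f - g) (ENNReal.ofReal p) := by
  have hp1 : 1 ≤ ENNReal.ofReal p := by simpa using hp.le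
  have heq : unitOperator φ ψ f - f =
      unitOperator φ ψ (f - g) + (unitOperator φ ψ g - g) - (f - g) := by
    funext x
    simp only [Pi.sub_apply, Pi.add_apply, h.unitOperator_sub hp hf hg x]
    ring
  have hm₁ : AEStronglyMeasurable (unitOperator φ ψ (f - g)) volume := (h.memLp hp (hf.sub hg)).1
  have hm₂ : AEStronglyMeasurable (unitOperator φ ψ g - g) volume := ((h.memLp hp hg).sub hg).1
  have h1 := eLpNorm_sub_le (hm₁.add hm₂) (hf.sub hg).1 hp1
  have h2 := eLpNorm_add_le hm₁ hm₂ hp1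
  rw [heq]
  exact h1.trans (by gcongr)

/-- The estimate at scale `1` for bounded continuous functions, by comparison with the smoothing. -/
lemma KernelPair.exists_eLpNorm_sub_le_modulus_of_continuous (h : KernelPair φ ψ A B θ)
    (hp : 1 < p) {r : ℕ} (hr0 : r ≠ 0) (hr : (r : ℝ) + 1 < θ)
    (hφ0 : ∀ u, discreteMoment φ 0 u = 1) (hψ0 : continuousMoment ψ 0 = 1)
    (hv : VanishingMoments φ ψ r) :
    ∃ C : ℝ≥0∞, C ≠ ⊤ ∧ ∀ f : ℝ → ℝ, Continuous f → (∃ M, ∀ x, |f x| ≤ M) →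
      MemLp f (ENNReal.ofReal p) →
      eLpNorm (unitOperator φ ψ f - f) (ENNReal.ofReal p) ≤
        C * modulus r f 1 (ENNReal.ofReal p) := by
  obtain ⟨C₁, hC₁, h₁⟩ := h.exists_eLpNorm_le hp
  obtain ⟨C₂, hC₂, h₂⟩ := h.exists_eLpNorm_sub_le hp hr0 hr hφ0 hψ0 hv
  have hp1 : 1 ≤ ENNReal.ofReal p := by simpa using hp.le
  obtain ⟨C₄, hC₄, h₄⟩ := exists_modulus_le r hp1
  have hC₃ : ∑ j ∈ Finset.range r, ‖smoothingCoeff r j‖ₑ ≠ ⊤ :=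
    ENNReal.sum_ne_top.2 fun _ _ => enorm_ne_top
  set C₃ := ∑ j ∈ Finset.range r, ‖smoothingCoeff r j‖ₑ
  refine ⟨C₁ + C₂ * C₃ + 1, by finiteness, fun f hf ⟨M, hM⟩ hfp => ?_⟩
  set g := smoothing r f 0 with hg
  set ω := modulus r f 1 (ENNReal.ofReal p)
  have hω : ω < ⊤ :=
    (h₄ f 1 hfp.1).trans_lt (ENNReal.mul_lt_top hC₄.lt_top hfp.2)
  have hsub : eLpNorm (f - g) (ENNReal.ofReal p) ≤ ω := eLpNorm_sub_smoothing_le hr0 hp hf hM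
  have hfg : MemLp (f - g) (ENNReal.ofReal p) :=
    ⟨(hf.sub (continuous_smoothing r 0 hf)).aestronglyMeasurable, hsub.trans_lt hω⟩
  have hgp : MemLp g (ENNReal.ofReal p) := by simpa using hfp.sub hfg
  have hDg := h₂ (smoothing r f) (fun i hi => hasDerivAt_smoothing hi hf)
    (continuous_smoothing r r hf) hgp
  refine (h.eLpNorm_sub_le_add hp hfp hgp).trans ?_
  calc _ ≤ C₁ * ω + C₂ * (C₃ * ω) + ω :=
        add_le_add (add_le_add ((h₁ _ hfg).trans (mul_le_mul_right hsub _))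
          (hDg.trans (mul_le_mul_right (eLpNorm_smoothing_le r hp1 hf) _))) hsub
    _ = _ := by ring

/-- The estimate at scale `1`, extended from `C_c` to `L^p`: both sides are continuous in `f`. -/
lemma KernelPair.exists_eLpNorm_sub_le_modulus (h : KernelPair φ ψ A B θ)
    (hp : 1 < p) {r : ℕ} (hr0 : r ≠ 0) (hr : (r : ℝ) + 1 < θ)
    (hφ0 : ∀ u, discreteMoment φ 0 u = 1) (hψ0 : continuousMoment ψ 0 = 1)
    (hv : VanishingMoments φ ψ r) :
    ∃ C : ℝ≥0∞, C ≠ ⊤ ∧ ∀ f : ℝ → ℝ, MemLp f (ENNReal.ofReal p) →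
      eLpNorm (unitOperator φ ψ f - f) (ENNReal.ofReal p) ≤
        C * modulus r f 1 (ENNReal.ofReal p) := by
  obtain ⟨C₁, hC₁, h₁⟩ := h.exists_eLpNorm_le hp
  obtain ⟨C, hC, h₂⟩ := h.exists_eLpNorm_sub_le_modulus_of_continuous hp hr0 hr hφ0 hψ0 hv
  have hp1 : 1 ≤ ENNReal.ofReal p := by simpa using hp.le
  obtain ⟨C₄, hC₄, h₄⟩ := exists_modulus_le r hp1
  refine ⟨C, hC, fun f hf => ?_⟩
  have hL : C₁ + C * C₄ + 1 ≠ ⊤ := by finiteness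
  have hL0 : C₁ + C * C₄ + 1 ≠ 0 := by simp
  refine ENNReal.le_of_forall_pos_le_add fun ε hε _ => ?_
  -- replacing `f` by `g` with `‖f - g‖ ≤ δ` costs at most `(C₁ + C * C₄ + 1) * δ`
  have hε' : (ε : ℝ≥0∞) / (C₁ + C * C₄ + 1) ≠ 0 :=
    (ENNReal.div_pos (by exact_mod_cast hε.ne') hL).ne'
  obtain ⟨g, hgs, hfg, hgc, hg⟩ :=
    hf.exists_hasCompactSupport_eLpNorm_sub_le ENNReal.ofReal_ne_top hε'
  set δ : ℝ≥0∞ := (ε : ℝ≥0∞) / (C₁ + C * C₄ + 1)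
  have hfgp : MemLp (f - g) (ENNReal.ofReal p) := hf.sub hg
  have hgf : eLpNorm (g - f) (ENNReal.ofReal p) ≤ δ := (eLpNorm_sub_comm g f _ _).trans_le hfg
  have hbdd : ∃ M, ∀ x, |g x| ≤ M := hgs.exists_bound_of_continuous hgc
  have hmod : modulus r g 1 (ENNReal.ofReal p) ≤ modulus r f 1 (ENNReal.ofReal p) + C₄ * δ := by
    have h5 := modulus_add_le r hp1 hf.1 (hg.sub hf).1 1
    rw [add_sub_cancel] at h5
    exact h5.trans (add_le_add_right ((h₄ _ 1 (hg.sub hf).1).trans (mul_le_mul_right hgf _)) _)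
  refine (h.eLpNorm_sub_le_add hp hf hg).trans ?_
  calc _ ≤ C₁ * δ + C * (modulus r f 1 (ENNReal.ofReal p) + C₄ * δ) + δ :=
        add_le_add (add_le_add ((h₁ _ hfgp).trans (mul_le_mul_right hfg _))
          ((h₂ g hgc hbdd hg).trans (mul_le_mul_right hmod _))) hfg
    _ = C * modulus r f 1 (ENNReal.ofReal p) + (C₁ + C * C₄ + 1) * δ := by ring
    _ = _ := by rw [ENNReal.mul_div_cancel hL0 hL]

lemma eLpNorm_comp_mul_left {w : ℝ} (hw : w ≠ 0) {q : ℝ≥0∞} (hq : q ≠ ⊤) (F : ℝ → ℝ) :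
    eLpNorm (fun x => F (w * x)) q =
      ENNReal.ofReal |w⁻¹| ^ (1 / q).toReal * eLpNorm F q := by
  have he : MeasurableEmbedding fun x : ℝ => w * x :=
    (Homeomorph.mulLeft₀ w hw).measurableEmbedding
  have h := he.eLpNorm_map_measure (g := F) (p := q) (μ := volume)
  rw [Real.map_volume_mul_left hw, eLpNorm_smul_measure_of_ne_top hq, smul_eq_mul] at h
  exact h.symm

lemma memLp_comp_mul_left {w : ℝ} (hw : w ≠ 0) {q : ℝ≥0∞} (hq : q ≠ ⊤) {F : ℝ → ℝ}
    (hF : MemLp F q) : MemLp (fun x => F (w * x)) q := by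
  have hqmp : Measure.QuasiMeasurePreserving (fun x : ℝ => w * x) volume volume := by
    refine ⟨measurable_const_mul w, ?_⟩
    rw [Real.map_volume_mul_left hw]
    exact Measure.smul_absolutelyContinuous
  refine ⟨hF.1.comp_quasiMeasurePreserving hqmp, ?_⟩
  rw [eLpNorm_comp_mul_left hw hq]
  exact ENNReal.mul_lt_top
    (ENNReal.rpow_lt_top_of_nonneg ENNReal.toReal_nonneg ENNReal.ofReal_ne_top) hF.2

lemma mul_integral_eq_integral_dilate {w : ℝ} (hw : 0 < w) (ψ f : ℝ → ℝ) (k : ℤ) :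
    w * ∫ u, ψ (w * u - k) * f u = ∫ v, ψ (v - k) * f (w⁻¹ * v) := by
  have h := Measure.integral_comp_mul_left (fun v => ψ (v - k) * f (w⁻¹ * v)) w
  simp only [inv_mul_cancel_left₀ hw.ne'] at h
  rw [h, abs_of_pos (inv_pos.2 hw), smul_eq_mul, mul_inv_cancel_left₀ hw.ne']

lemma operator_eq_unitOperator {w : ℝ} (hw : 0 < w) (φ ψ f : ℝ → ℝ) (x : ℝ) :
    operator φ ψ w f x = unitOperator φ ψ (fun y => f (w⁻¹ * y)) (w * x) := by
  simp only [operator, unitOperator, mul_integral_eq_integral_dilate hw]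

lemma modulus_dilate_le {w : ℝ} (hw : 0 < w) (r : ℕ) {q : ℝ≥0∞} (hq : q ≠ ⊤) (f : ℝ → ℝ) :
    ENNReal.ofReal |w⁻¹| ^ (1 / q).toReal * modulus r (fun y => f (w⁻¹ * y)) 1 q ≤
      modulus r f (1 / w) q := by
  simp only [modulus, ENNReal.mul_iSup]
  refine iSup₂_le fun t ht => ?_
  have heq : (fun x => finiteDiff r t (fun y => f (w⁻¹ * y)) (w * x)) =
      finiteDiff r (w⁻¹ * t) f := by
    funext x
    simp only [finiteDiff]
    refine Finset.sum_congr rfl fun j _ => ?_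
    rw [mul_add, inv_mul_cancel_left₀ hw.ne', mul_left_comm]
  rw [← eLpNorm_comp_mul_left hw.ne' hq, heq]
  refine eLpNorm_finiteDiff_le_modulus r f ?_ q
  rw [abs_mul, abs_of_pos (inv_pos.2 hw), one_div]
  exact mul_le_of_le_one_right (inv_pos.2 hw).le ht

end

end Durrmeyer

theorem mainTheorem4 (r : ℕ) (hr : 1 < r) (p : ℝ) (hp : 1 < p)
    (φ ψ : ℝ → ℝ)
    (hφ : Durrmeyer.IsDiscreteKernel φ) (hψ : Durrmeyer.IsContinuousKernel ψ)
    (hM : Durrmeyer.discreteAbsMoment ψ 0 < ⊤)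
    (h_i : Durrmeyer.ConstantMoments φ r)
    (h_ii : Durrmeyer.VanishingMoments φ ψ r)
    (θ : ℝ) (hθ : p * r + 1 < θ)
    (hφθ : Durrmeyer.DecayCondition φ θ) (hψθ : Durrmeyer.DecayCondition ψ θ) :
    ∃ Γ : ℝ, 0 < Γ ∧
      ∀ f : ℝ → ℝ, MemLp f (ENNReal.ofReal p) volume → ∀ w : ℝ, 0 < w →
        (∀ k : ℤ, Integrable (fun u : ℝ => ψ (w * u - k) * f u) volume) ∧
        (∀ x : ℝ, Summable fun k : ℤ =>
          φ (w * x - k) * (w * ∫ u : ℝ, ψ (w * u - k) * f u)) ∧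
        MemLp (Durrmeyer.operator φ ψ w f) (ENNReal.ofReal p) volume ∧
        eLpNorm (fun x => Durrmeyer.operator φ ψ w f x - f x) (ENNReal.ofReal p) volume ≤
          ENNReal.ofReal Γ * Durrmeyer.modulus r f (1 / w) (ENNReal.ofReal p) := by
  have hr1 : (1 : ℝ) < r := by exact_mod_cast hr
  have hθr : (r : ℝ) + 1 < θ := by nlinarith
  have hθ1 : 1 < θ := by linarith
  obtain ⟨Cφ, hCφ⟩ := hφ.bounded
  obtain ⟨Cψ, hCψ⟩ := Durrmeyer.exists_bound_of_discreteAbsMoment_lt_top hM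
  obtain ⟨A, -, hA⟩ := hφθ.exists_le_envelope (by linarith) hCφ
  obtain ⟨B, -, hB⟩ := hψθ.exists_le_envelope (by linarith) hCψ
  have hK : Durrmeyer.KernelPair φ ψ A B θ := ⟨hθ1, hφ.integrable.1, hψ.integrable.1, hA, hB⟩
  obtain ⟨C, hC, hmain⟩ := hK.exists_eLpNorm_sub_le_modulus hp (by omega : r ≠ 0) hθr
    hφ.moment_zero hψ.moment_zero h_ii
  -- the summand `1` makes the constant positive even if `C = 0`
  refine ⟨C.toReal + 1, by positivity, fun f hf w hw => ?_⟩
  have hg : MemLp (fun y => f (w⁻¹ * y)) (ENNReal.ofReal p) :=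
    Durrmeyer.memLp_comp_mul_left (inv_ne_zero hw.ne') ENNReal.ofReal_ne_top hf
  refine ⟨fun k => ?_, fun x => ?_, ?_, ?_⟩
  · simpa [inv_mul_cancel_left₀ hw.ne'] using (hK.integrable hp hg k).comp_mul_left' hw.ne'
  · simpa only [Durrmeyer.mul_integral_eq_integral_dilate hw] using hK.summable hp hg (w * x)
  · have h := Durrmeyer.memLp_comp_mul_left hw.ne' ENNReal.ofReal_ne_top (hK.memLp hp hg)
    simpa only [← Durrmeyer.operator_eq_unitOperator hw] using h
  · set g : ℝ → ℝ := fun y => f (w⁻¹ * y) with hgdef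
    have heq : (fun x => Durrmeyer.operator φ ψ w f x - f x) =
        fun x => (Durrmeyer.unitOperator φ ψ g - g) (w * x) := by
      funext x
      simp only [Durrmeyer.operator_eq_unitOperator hw, Pi.sub_apply, hgdef,
        inv_mul_cancel_left₀ hw.ne']
    rw [heq, Durrmeyer.eLpNorm_comp_mul_left hw.ne' ENNReal.ofReal_ne_top]
    calc _ ≤ ENNReal.ofReal |w⁻¹| ^ (1 / ENNReal.ofReal p).toReal *
          (C * Durrmeyer.modulus r g 1 (ENNReal.ofReal p)) := by gcongr; exact hmain g hg
      _ = C * (ENNReal.ofReal |w⁻¹| ^ (1 / ENNReal.ofReal p).toReal *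
          Durrmeyer.modulus r g 1 (ENNReal.ofReal p)) := by ring
      _ ≤ ENNReal.ofReal (C.toReal + 1) * Durrmeyer.modulus r f (1 / w) (ENNReal.ofReal p) := by
          gcongr
          · exact (ENNReal.ofReal_toReal hC).symm.le.trans
              (ENNReal.ofReal_le_ofReal (by linarith))
          · exact Durrmeyer.modulus_dilate_le hw r ENNReal.ofReal_ne_top f
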